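/- Let $n\ge 3$ be an integer, $\mu\in[0,(n-2)^2/4)$, $c\le 0$ and $\rho>0$. Put $\mathbf{ct}_0(r)=1/r$ and $\mathbf{ct}_c(r)=\sqrt{-c}\,\coth(\sqrt{-c}\,r)$ for $c<0$, $r>0$. Consider the singular problem $$f''(r)+(n-1)f'(r)\,\mathbf{ct}_c(r)+\mu\frac{f(r)}{r^2}+1=0,\quad r\in(0,\rho],\qquad f(\rho)=0,\qquad \int_0^\rho f'(r)^2\,r^{n-1}\,dr<\infty,$$ where a solution is a twice differentiable function $f:(0,\rho]\to\mathbb R$ (with left-hand derivatives at $\rho$) satisfying all three conditions. This problem has exactly one solution; this solution is non-negative and non-increasing on $(0,\rho]$ and belongs to $C^\infty(0,\rho)$. In particular, it is the unique non-negative, non-increasing solution. -/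

import Mathlib

open scoped ContDiff

/-- The function `ct_c` on `(0, ∞)`, for `c ≤ 0`: it is `1 / r` if `c = 0` and
`√(-c) * coth (√(-c) * r)` if `c < 0`. -/
noncomputable def ct (c r : ℝ) : ℝ :=
  if c = 0 then 1 / r
  else √(-c) * (Real.cosh (√(-c) * r) / Real.sinh (√(-c) * r))

/-- `f` solves the singular boundary value problem
`f'' + (n - 1) f' ct_c(r) + μ f / r² + 1 = 0` on `(0, ρ]`, `f(ρ) = 0`,
`∫₀^ρ f'(r)² r^(n-1) dr < ∞`.
Only the values of `f` on `(0, ρ]` matter: derivatives are taken relative to `(0, ρ]`, so they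
are the usual ones on `(0, ρ)` and the left-hand ones at `ρ`. -/
structure IsSingularODESolution (n : ℕ) (μ c ρ : ℝ) (f : ℝ → ℝ) : Prop where
  differentiableOn : DifferentiableOn ℝ f (Set.Ioc 0 ρ)
  differentiableOn_deriv :
    DifferentiableOn ℝ (derivWithin f (Set.Ioc 0 ρ)) (Set.Ioc 0 ρ)
  ode : ∀ r ∈ Set.Ioc 0 ρ,
    derivWithin (derivWithin f (Set.Ioc 0 ρ)) (Set.Ioc 0 ρ) r
      + ((n : ℝ) - 1) * derivWithin f (Set.Ioc 0 ρ) r * ct c r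
      + μ * (f r / r ^ 2) + 1 = 0
  boundary : f ρ = 0
  finite_energy : MeasureTheory.IntegrableOn
    (fun r : ℝ => derivWithin f (Set.Ioc 0 ρ) r ^ 2 * r ^ (n - 1)) (Set.Ioc 0 ρ)

open Filter Topology
open scoped ContDiff BoundedContinuousFunction

/-! Let `γ` be the smaller root of `γ(n-2) - γ² = μ`, so that `r^(-γ)` solves the Euler equation
obtained by replacing `ct` with `1/r`. Writing `f = r^(-γ) u` removes the inverse-square term: the
equation becomes `(W u')' = W (q u - r^γ)` with `W = r^(-2γ) sn^(n-1)` increasing and `0 ≤ q`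
bounded.

Existence: integrating twice from 0 gives a Volterra equation, solved by contraction
(`exists_weighted_volterra_solution`). With `u₁` homogeneous and `u₂` inhomogeneous, `u = u₂ - k u₁`
is made to vanish at `ρ`. A Wronskian argument (`antitoneOn_quotient`) shows `u₂/u₁` non-increasing,
so `u ≥ 0`. The bound `f' = O(r^(-γ-1))` gives finite energy because `2γ < n-2`, and `(sn^(n-1) f')'
≤ 0` gives monotonicity.

Uniqueness (`homogeneous_solution_eq_zero`): for a difference `h` of solutions and `v = r^γ h`, the
quantity `(W v')²` is non-increasing. If `v'` is not identically zero, then `h'² r^(n-1)` dominates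
a multiple of `r^(2γ-n+1)` near 0, which is not integrable. -/

/-! ### Bounds for the generalized sine and cotangent. -/

theorem sinh_le_mul_cosh {x : ℝ} (hx : 0 ≤ x) : Real.sinh x ≤ x * Real.cosh x := by
  have hd : ∀ y : ℝ, HasDerivAt (fun y => y * Real.cosh y - Real.sinh y) (y * Real.sinh y) y := by
    intro y
    refine (((hasDerivAt_id y).mul (Real.hasDerivAt_cosh y)).sub
      (Real.hasDerivAt_sinh y)).congr_deriv ?_
    simp
  have hm : MonotoneOn (fun y => y * Real.cosh y - Real.sinh y) (Set.Ici (0 : ℝ)) := by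
    apply monotoneOn_of_deriv_nonneg (convex_Ici 0)
    · exact fun y _ => (hd y).continuousAt.continuousWithinAt
    · exact fun y _ => (hd y).differentiableAt.differentiableWithinAt
    · intro y hy
      rw [interior_Ici] at hy
      rw [(hd y).deriv]
      exact mul_nonneg (le_of_lt hy) (Real.sinh_nonneg_iff.2 (le_of_lt hy))
  have := hm (Set.mem_Ici.2 le_rfl) (Set.mem_Ici.2 hx) hx
  simp at this
  exact this

theorem mul_cosh_le_sinh_add {x : ℝ} (hx : 0 ≤ x) :
    x * Real.cosh x ≤ Real.sinh x + x ^ 2 * Real.sinh x := by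
  have hd : ∀ y : ℝ, HasDerivAt (fun y => Real.sinh y + y ^ 2 * Real.sinh y - y * Real.cosh y)
      (y * Real.sinh y + y ^ 2 * Real.cosh y) y := by
    intro y
    refine (((Real.hasDerivAt_sinh y).add ((hasDerivAt_pow 2 y).mul
      (Real.hasDerivAt_sinh y))).sub
      ((hasDerivAt_id y).mul (Real.hasDerivAt_cosh y))).congr_deriv ?_
    simp
    ring
  have hm : MonotoneOn (fun y => Real.sinh y + y ^ 2 * Real.sinh y - y * Real.cosh y)
      (Set.Ici (0 : ℝ)) := by
    apply monotoneOn_of_deriv_nonneg (convex_Ici 0)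
    · exact fun y _ => (hd y).continuousAt.continuousWithinAt
    · exact fun y _ => (hd y).differentiableAt.differentiableWithinAt
    · intro y hy
      rw [interior_Ici] at hy
      rw [(hd y).deriv]
      have := Real.sinh_nonneg_iff.2 (le_of_lt hy)
      have := (Real.cosh_pos y).le
      have : 0 < y := hy
      positivity
  have := hm (Set.mem_Ici.2 le_rfl) (Set.mem_Ici.2 hx) hx
  simp at this
  linarith

/-- The generalized sine: `r` if `c = 0`, and `sinh (√(-c) r) / √(-c)` if `c < 0`. -/
noncomputable def sn (c r : ℝ) : ℝ := if c = 0 then r else Real.sinh (√(-c) * r) / √(-c)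

theorem sn_pos {c r : ℝ} (hc : c ≤ 0) (hr : 0 < r) : 0 < sn c r := by
  unfold sn
  split_ifs with h
  · exact hr
  · have hk : 0 < √(-c) := Real.sqrt_pos.2 (by have := lt_of_le_of_ne hc h; linarith)
    exact div_pos (Real.sinh_pos_iff.2 (by positivity)) hk

theorem hasDerivAt_sn {c r : ℝ} (hc : c ≤ 0) (hr : 0 < r) :
    HasDerivAt (sn c) (sn c r * ct c r) r := by
  unfold sn ct
  split_ifs with h
  · exact (hasDerivAt_id r).congr_deriv (mul_one_div_cancel hr.ne').symm
  · have hk : 0 < √(-c) := Real.sqrt_pos.2 (by have := lt_of_le_of_ne hc h; linarith)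
    have hs : 0 < Real.sinh (√(-c) * r) := Real.sinh_pos_iff.2 (by positivity)
    refine ((((hasDerivAt_id r).const_mul √(-c)).sinh).div_const √(-c)).congr_deriv ?_
    simp only [id, mul_one]
    rw [mul_div_assoc, div_self hk.ne']
    generalize √(-c) = k at hk hs
    field_simp

theorem exists_sn_le {c ρ : ℝ} (hc : c ≤ 0) (hρ : 0 < ρ) :
    ∃ C, 0 < C ∧ ∀ r ∈ Set.Ioc 0 ρ, sn c r ≤ C * r := by
  by_cases h : c = 0
  · exact ⟨1, one_pos, fun r _ => by simp [sn, h]⟩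
  · have hk : 0 < √(-c) := Real.sqrt_pos.2 (by have := lt_of_le_of_ne hc h; linarith)
    refine ⟨Real.cosh (√(-c) * ρ), Real.cosh_pos _, fun r hr => ?_⟩
    simp only [sn, h, if_false]
    have h1 := sinh_le_mul_cosh (mul_pos hk hr.1).le
    have h2 : Real.cosh (√(-c) * r) ≤ Real.cosh (√(-c) * ρ) := by
      rw [Real.cosh_le_cosh, abs_of_pos (mul_pos hk hr.1), abs_of_pos (mul_pos hk hρ)]
      exact mul_le_mul_of_nonneg_left hr.2 hk.le
    rw [div_le_iff₀ hk]
    have := mul_le_mul_of_nonneg_left h2 (mul_pos hk hr.1).le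
    linarith

theorem inv_le_ct {c r : ℝ} (hc : c ≤ 0) (hr : 0 < r) : 1 / r ≤ ct c r := by
  unfold ct
  split_ifs with h
  · exact le_rfl
  · have hk : 0 < √(-c) := Real.sqrt_pos.2 (by have := lt_of_le_of_ne hc h; linarith)
    have hs : 0 < Real.sinh (√(-c) * r) := Real.sinh_pos_iff.2 (by positivity)
    have h1 := sinh_le_mul_cosh (mul_pos hk hr).le
    rw [← mul_div_assoc, div_le_div_iff₀ hr hs]
    linarith

/-- Follows from `x coth x ≤ 1 + x²`. The excess of `ct` over `1/r` is linear in `r`, which is what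
keeps the potential `q` bounded at 0. -/
theorem ct_le_inv_add {c r : ℝ} (hc : c ≤ 0) (hr : 0 < r) : ct c r ≤ 1 / r + (-c) * r := by
  unfold ct
  split_ifs with h
  · simp [h]
  · have hk : 0 < √(-c) := Real.sqrt_pos.2 (by have := lt_of_le_of_ne hc h; linarith)
    have hs : 0 < Real.sinh (√(-c) * r) := Real.sinh_pos_iff.2 (by positivity)
    have h1 := mul_cosh_le_sinh_add (mul_pos hk hr).le
    have h2 : √(-c) ^ 2 = -c := Real.sq_sqrt (by linarith)
    have h3 : 1 / r + (-c) * r = (1 + (-c) * r ^ 2) / r := by field_simp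
    rw [h3, ← mul_div_assoc, div_le_div_iff₀ hs hr]
    rw [mul_pow, h2] at h1
    linarith

theorem contDiffOn_ct {c : ℝ} (hc : c ≤ 0) : ContDiffOn ℝ ∞ (ct c) (Set.Ioi 0) := by
  unfold ct
  split_ifs with h
  · exact contDiffOn_const.div contDiffOn_id fun x hx => ne_of_gt hx
  · have hk : 0 < √(-c) := Real.sqrt_pos.2 (by have := lt_of_le_of_ne hc h; linarith)
    refine contDiffOn_const.mul (ContDiffOn.div ?_ ?_ fun x hx => ?_)
    · exact (Real.contDiff_cosh.comp (contDiff_const.mul contDiff_id)).contDiffOn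
    · exact (Real.contDiff_sinh.comp (contDiff_const.mul contDiff_id)).contDiffOn
    · exact (Real.sinh_pos_iff.2 (mul_pos hk hx)).ne'

/-! ### The weighted integral operator and exponential bounds. -/

section WeightedVolterra

variable {W h : ℝ → ℝ} {M l : ℝ}

/-- `(W r)⁻¹ ∫₀^r W h`: the solution `z` of `(W z)' = W h` with `W z → 0` at `0`. -/
noncomputable def weightedPrimitive (W h : ℝ → ℝ) (t : ℝ) : ℝ := (∫ x in (0 : ℝ)..t, W x * h x) / W t

theorem intervalIntegrable_weight_mul (hWc : ContinuousOn W (Set.Ioi 0))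
    (hWp : ∀ r > 0, 0 < W r) (hWm : MonotoneOn W (Set.Ioi 0)) (hM : 0 ≤ M) (hl : 0 < l)
    (hc : ContinuousOn h (Set.Ioi 0)) (hb : ∀ r > 0, |h r| ≤ M * Real.exp (l * r))
    {t : ℝ} (ht : 0 ≤ t) : IntervalIntegrable (fun x => W x * h x) MeasureTheory.volume 0 t := by
  rw [intervalIntegrable_iff_integrableOn_Ioc_of_le ht]
  rcases ht.eq_or_lt with rfl | ht
  · simp
  refine ⟨?_, MeasureTheory.HasFiniteIntegral.restrict_of_bounded
    (C := W t * (M * Real.exp (l * t))) (by simp) ?_⟩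
  · exact ((hWc.mul hc).mono Set.Ioc_subset_Ioi_self).aestronglyMeasurable measurableSet_Ioc
  · refine (MeasureTheory.ae_restrict_iff' measurableSet_Ioc).2 (.of_forall fun x hx => ?_)
    rw [Real.norm_eq_abs, abs_mul, abs_of_pos (hWp x hx.1)]
    refine mul_le_mul (hWm hx.1 ht hx.2) ((hb x hx.1).trans ?_) (abs_nonneg _) (hWp t ht).le
    exact mul_le_mul_of_nonneg_left
      (Real.exp_le_exp.2 (mul_le_mul_of_nonneg_left hx.2 hl.le)) hM

theorem integral_exp_const_mul_le (hl : 0 < l) (t : ℝ) :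
    ∫ x in (0 : ℝ)..t, Real.exp (l * x) ≤ Real.exp (l * t) / l := by
  have h : ∀ x ∈ Set.uIcc 0 t, HasDerivAt (fun x => Real.exp (l * x) / l) (Real.exp (l * x)) x := by
    intro x _
    refine ((((hasDerivAt_id x).const_mul l).exp).div_const l).congr_deriv ?_
    simp
    field_simp
  rw [intervalIntegral.integral_eq_sub_of_hasDerivAt h
    (Continuous.intervalIntegrable (by fun_prop) _ _)]
  have : 0 < 1 / l := by positivity
  simp at this ⊢
  linarith

theorem abs_integral_le_of_abs_le_exp (hM : 0 ≤ M) (hl : 0 < l)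
    (hb : ∀ r > 0, |h r| ≤ M * Real.exp (l * r)) {t : ℝ} (ht : 0 ≤ t) :
    |∫ x in (0 : ℝ)..t, h x| ≤ M / l * Real.exp (l * t) := by
  have h1 : ‖∫ x in (0 : ℝ)..t, h x‖ ≤ ∫ x in (0 : ℝ)..t, M * Real.exp (l * x) :=
    intervalIntegral.norm_integral_le_of_norm_le ht
      (.of_forall fun x hx => hb x hx.1) (Continuous.intervalIntegrable (by fun_prop) _ _)
  rw [intervalIntegral.integral_const_mul] at h1
  calc _ ≤ _ := h1
    _ ≤ M * (Real.exp (l * t) / l) :=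
      mul_le_mul_of_nonneg_left (integral_exp_const_mul_le hl t) hM
    _ = _ := by ring

/-- Since `W` is monotone, `W x ≤ W t` under the integral and the weight cancels. Integrating the
exponential gains a factor `1/l`. -/
theorem abs_weightedPrimitive_le
    (hWp : ∀ r > 0, 0 < W r) (hWm : MonotoneOn W (Set.Ioi 0)) (hM : 0 ≤ M) (hl : 0 < l)
    (hb : ∀ r > 0, |h r| ≤ M * Real.exp (l * r)) {t : ℝ} (ht : 0 < t) :
    |weightedPrimitive W h t| ≤ M / l * Real.exp (l * t) := by
  rw [weightedPrimitive, abs_div, abs_of_pos (hWp t ht), div_le_iff₀ (hWp t ht)]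
  have h1 : ‖∫ x in (0 : ℝ)..t, W x * h x‖ ≤ ∫ x in (0 : ℝ)..t, W t * (M * Real.exp (l * x)) := by
    refine intervalIntegral.norm_integral_le_of_norm_le ht.le
      (.of_forall fun x hx => ?_) (Continuous.intervalIntegrable (by fun_prop) _ _)
    rw [Real.norm_eq_abs, abs_mul, abs_of_pos (hWp x hx.1)]
    exact mul_le_mul (hWm hx.1 ht hx.2) (hb x hx.1) (abs_nonneg _) (hWp t ht).le
  rw [intervalIntegral.integral_const_mul, intervalIntegral.integral_const_mul] at h1
  calc _ ≤ _ := h1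
    _ ≤ W t * (M * (Real.exp (l * t) / l)) :=
      mul_le_mul_of_nonneg_left (mul_le_mul_of_nonneg_left (integral_exp_const_mul_le hl t) hM)
        (hWp t ht).le
    _ = _ := by ring

theorem hasDerivAt_mul_weightedPrimitive (hWc : ContinuousOn W (Set.Ioi 0))
    (hWp : ∀ r > 0, 0 < W r) (hWm : MonotoneOn W (Set.Ioi 0)) (hM : 0 ≤ M) (hl : 0 < l)
    (hc : ContinuousOn h (Set.Ioi 0)) (hb : ∀ r > 0, |h r| ≤ M * Real.exp (l * r))
    {t : ℝ} (ht : 0 < t) :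
    HasDerivAt (fun r => W r * weightedPrimitive W h r) (W t * h t) t := by
  have h1 : HasDerivAt (fun r => ∫ x in (0 : ℝ)..r, W x * h x) (W t * h t) t := by
    have hcw := hWc.mul hc
    refine intervalIntegral.integral_hasDerivAt_right
      (intervalIntegrable_weight_mul hWc hWp hWm hM hl hc hb ht.le) ?_
      (hcw.continuousAt (Ioi_mem_nhds ht))
    exact hcw.stronglyMeasurableAtFilter isOpen_Ioi t ht
  refine h1.congr_of_eventuallyEq ?_
  filter_upwards [Ioi_mem_nhds ht] with r hr
  rw [weightedPrimitive, mul_div_cancel₀ _ (hWp r hr).ne']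

theorem continuousOn_weightedPrimitive (hWc : ContinuousOn W (Set.Ioi 0))
    (hWp : ∀ r > 0, 0 < W r) (hWm : MonotoneOn W (Set.Ioi 0)) (hM : 0 ≤ M) (hl : 0 < l)
    (hc : ContinuousOn h (Set.Ioi 0)) (hb : ∀ r > 0, |h r| ≤ M * Real.exp (l * r)) :
    ContinuousOn (weightedPrimitive W h) (Set.Ioi 0) := by
  have h1 : ContinuousOn (fun r => W r * weightedPrimitive W h r) (Set.Ioi 0) := fun t ht =>
    (hasDerivAt_mul_weightedPrimitive hWc hWp hWm hM hl hc hb ht).continuousAt.continuousWithinAt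
  refine (h1.div hWc fun r hr => (hWp r hr).ne').congr fun r hr => ?_
  have := (hWp r hr).ne'
  simp only [Pi.div_apply]
  field_simp

theorem intervalIntegrable_of_abs_le_exp (hM : 0 ≤ M) (hl : 0 < l)
    (hc : ContinuousOn h (Set.Ioi 0)) (hb : ∀ r > 0, |h r| ≤ M * Real.exp (l * r))
    {t : ℝ} (ht : 0 ≤ t) : IntervalIntegrable h MeasureTheory.volume 0 t := by
  simpa using intervalIntegrable_weight_mul (W := fun _ => 1) continuousOn_const
    (fun _ _ => one_pos) (fun _ _ _ _ _ => le_rfl) hM hl hc hb ht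

/-- The even extension puts the iterates on all of `ℝ`, so that the fixed point can be sought among
bounded continuous functions on `ℝ`. -/
theorem continuous_integral_abs (hM : 0 ≤ M) (hl : 0 < l)
    (hc : ContinuousOn h (Set.Ioi 0)) (hb : ∀ r > 0, |h r| ≤ M * Real.exp (l * r)) :
    Continuous fun r : ℝ => ∫ x in (0 : ℝ)..|r|, h x := by
  have h1 : ContinuousOn (fun r : ℝ => ∫ x in (0 : ℝ)..r, h x) (Set.Ici 0) := by
    intro t ht
    have h2 : ContinuousOn (fun r : ℝ => ∫ x in (0 : ℝ)..r, h x) (Set.uIcc 0 (t + 1)) :=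
      intervalIntegral.continuousOn_primitive_interval
        ((intervalIntegrable_of_abs_le_exp hM hl hc hb (by
          have : 0 ≤ t := ht
          linarith : (0 : ℝ) ≤ t + 1)).def'.congr_set_ae (by
            rw [Set.uIcc, Set.uIoc]; exact MeasureTheory.Ioc_ae_eq_Icc.symm))
    have ht' : 0 ≤ t := ht
    rw [Set.uIcc_of_le (by linarith)] at h2
    refine (h2 t ⟨ht', by linarith⟩).mono_of_mem_nhdsWithin ?_
    filter_upwards [self_mem_nhdsWithin, mem_nhdsWithin_of_mem_nhds (Iio_mem_nhds (lt_add_one t))]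
      with r h3 h4 using ⟨h3, le_of_lt h4⟩
  exact h1.comp_continuous continuous_abs fun r => abs_nonneg r

end WeightedVolterra

/-! ### Solving the Volterra equation by contraction. -/

section WeightedVolterraEquation

variable {W q g : ℝ → ℝ} {Q G l : ℝ}

/-- The right-hand side `q u - g` for `u = e^(l x) y`. -/
noncomputable def volterraSource (q g : ℝ → ℝ) (l : ℝ) (y : ℝ →ᵇ ℝ) (x : ℝ) : ℝ :=
  q x * (Real.exp (l * x) * y x) - g x

theorem continuousOn_volterraSource (hqc : ContinuousOn q (Set.Ioi 0))
    (hgc : ContinuousOn g (Set.Ioi 0)) (y : ℝ →ᵇ ℝ) :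
    ContinuousOn (volterraSource q g l y) (Set.Ioi 0) := by
  have : Continuous fun x => Real.exp (l * x) * y x := by fun_prop
  exact (hqc.mul this.continuousOn).sub hgc

theorem abs_volterraSource_le (hq : ∀ r > 0, 0 ≤ q r) (hqQ : ∀ r > 0, q r ≤ Q)
    (hg : ∀ r > 0, |g r| ≤ G * Real.exp (l * r)) (y : ℝ →ᵇ ℝ) (r : ℝ) (hr : 0 < r) :
    |volterraSource q g l y r| ≤ (Q * ‖y‖ + G) * Real.exp (l * r) := by
  have h1 : |q r * (Real.exp (l * r) * y r)| ≤ Q * (Real.exp (l * r) * ‖y‖) := by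
    rw [abs_mul, abs_mul, abs_of_nonneg (hq r hr), abs_of_pos (Real.exp_pos _)]
    refine mul_le_mul (hqQ r hr) (mul_le_mul_of_nonneg_left ?_ (Real.exp_pos _).le)
      (by positivity) ((hq r hr).trans (hqQ r hr))
    exact y.norm_coe_le_norm r
  calc _ ≤ |q r * (Real.exp (l * r) * y r)| + |g r| := abs_sub _ _
    _ ≤ Q * (Real.exp (l * r) * ‖y‖) + G * Real.exp (l * r) := add_le_add h1 (hg r hr)
    _ = _ := by ring

/-- The equation is `u = a + ∫ W⁻¹ ∫ W (q u - g)`. In the norm `sup e^(-l|r|) |u|` each of the two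
integrations gains `1/l`, so the map contracts with factor `Q / l² < 1`. -/
theorem exists_weighted_volterra_solution (hWc : ContinuousOn W (Set.Ioi 0))
    (hWp : ∀ r > 0, 0 < W r) (hWm : MonotoneOn W (Set.Ioi 0))
    (hqc : ContinuousOn q (Set.Ioi 0)) (hq : ∀ r > 0, 0 ≤ q r) (hqQ : ∀ r > 0, q r ≤ Q)
    (hgc : ContinuousOn g (Set.Ioi 0)) (hG : 0 ≤ G)
    (hg : ∀ r > 0, |g r| ≤ G * Real.exp (l * r)) (hl : 0 < l) (hlQ : Q < l ^ 2) (a : ℝ) :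
    ∃ (u z : ℝ → ℝ) (M : ℝ), 0 ≤ M ∧ Continuous u ∧ u 0 = a ∧
      (∀ r > 0, HasDerivAt u (z r) r) ∧
      (∀ r > 0, HasDerivAt (fun r => W r * z r) (W r * (q r * u r - g r)) r) ∧
      ∀ r > 0, |z r| ≤ M * Real.exp (l * r) := by
  have hQ : 0 ≤ Q := (hq 1 one_pos).trans (hqQ 1 one_pos)
  set S : (ℝ →ᵇ ℝ) → ℝ → ℝ := volterraSource q g l with hS
  set N : (ℝ →ᵇ ℝ) → ℝ := fun y => Q * ‖y‖ + G with hN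
  have hN0 : ∀ y, 0 ≤ N y := fun y => by simp only [hN]; positivity
  have hSc : ∀ y, ContinuousOn (S y) (Set.Ioi 0) := continuousOn_volterraSource hqc hgc
  have hSb : ∀ y, ∀ r > 0, |S y r| ≤ N y * Real.exp (l * r) := abs_volterraSource_le hq hqQ hg
  set A : (ℝ →ᵇ ℝ) → ℝ → ℝ := fun y => weightedPrimitive W (S y) with hA
  have hAc : ∀ y, ContinuousOn (A y) (Set.Ioi 0) := fun y =>
    continuousOn_weightedPrimitive hWc hWp hWm (hN0 y) hl (hSc y) (hSb y)
  have hAb : ∀ y, ∀ r > 0, |A y r| ≤ N y / l * Real.exp (l * r) := fun y r hr =>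
    abs_weightedPrimitive_le hWp hWm (hN0 y) hl (hSb y) hr
  have hNl : ∀ y, 0 ≤ N y / l := fun y => div_nonneg (hN0 y) hl.le
  -- The source is affine in `y`, so `g` cancels in differences and only `Q` enters the constant.
  have hsub : ∀ y w, ∀ r > 0, |A y r - A w r| ≤ Q * dist y w / l * Real.exp (l * r) := by
    intro y w r hr
    have h1 : A y r - A w r = weightedPrimitive W (fun x => S y x - S w x) r := by
      simp only [hA, weightedPrimitive]
      rw [← sub_div, ← intervalIntegral.integral_sub
        (intervalIntegrable_weight_mul hWc hWp hWm (hN0 y) hl (hSc y) (hSb y) hr.le)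
        (intervalIntegrable_weight_mul hWc hWp hWm (hN0 w) hl (hSc w) (hSb w) hr.le)]
      simp only [mul_sub]
    rw [h1]
    refine abs_weightedPrimitive_le hWp hWm (by positivity) hl (fun x hx => ?_) hr
    have h2 : S y x - S w x = q x * (Real.exp (l * x) * (y x - w x)) := by
      simp only [hS, volterraSource]; ring
    rw [h2, abs_mul, abs_mul, abs_of_nonneg (hq x hx), abs_of_pos (Real.exp_pos _)]
    have h3 : |y x - w x| ≤ dist y w := by
      rw [← Real.dist_eq]
      exact BoundedContinuousFunction.dist_coe_le_dist x
    calc _ ≤ Q * (Real.exp (l * x) * dist y w) :=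
          mul_le_mul (hqQ x hx) (mul_le_mul_of_nonneg_left h3 (Real.exp_pos _).le)
            (by positivity) hQ
      _ = _ := by ring
  have hexp : ∀ r : ℝ, Real.exp (-(l * |r|)) * Real.exp (l * |r|) = 1 := fun r => by
    rw [← Real.exp_add]; simp
  have hbd : ∀ y r, ‖Real.exp (-(l * |r|)) * (a + ∫ x in (0 : ℝ)..|r|, A y x)‖
      ≤ |a| + N y / l / l := by
    intro y r
    have h1 := abs_integral_le_of_abs_le_exp (hNl y) hl (hAb y) (abs_nonneg r)
    rw [Real.norm_eq_abs, abs_mul, abs_of_pos (Real.exp_pos _)]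
    have h2 : Real.exp (-(l * |r|)) ≤ 1 := Real.exp_le_one_iff.2 (by
      have : 0 ≤ l * |r| := by positivity
      linarith)
    calc _ ≤ Real.exp (-(l * |r|)) * (|a| + N y / l / l * Real.exp (l * |r|)) :=
          mul_le_mul_of_nonneg_left ((abs_add_le _ _).trans (by gcongr)) (Real.exp_pos _).le
      _ = Real.exp (-(l * |r|)) * |a|
          + N y / l / l * (Real.exp (-(l * |r|)) * Real.exp (l * |r|)) := by ring
      _ ≤ 1 * |a| + N y / l / l * 1 := by
          rw [hexp]
          gcongr
      _ = _ := by ring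
  have hcont : ∀ y, Continuous fun r => a + ∫ x in (0 : ℝ)..|r|, A y x := fun y =>
    continuous_const.add (continuous_integral_abs (hNl y) hl (hAc y) (hAb y))
  have hcont' : ∀ y, Continuous fun r =>
      Real.exp (-(l * |r|)) * (a + ∫ x in (0 : ℝ)..|r|, A y x) := fun y =>
    Continuous.mul (by fun_prop) (hcont y)
  set T : (ℝ →ᵇ ℝ) → (ℝ →ᵇ ℝ) := fun y =>
    BoundedContinuousFunction.ofNormedAddCommGroup _ (hcont' y) _ (hbd y) with hT
  have hK : 0 ≤ Q / l ^ 2 := by positivity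
  have hcontr : ContractingWith (Q / l ^ 2).toNNReal T := by
    refine ⟨?_, LipschitzWith.of_dist_le_mul fun y w => ?_⟩
    · rw [Real.toNNReal_lt_one, div_lt_one (by positivity)]
      exact hlQ
    · rw [Real.coe_toNNReal _ hK, BoundedContinuousFunction.dist_le (by positivity)]
      intro r
      have h1 : T y r - T w r =
          Real.exp (-(l * |r|)) * ∫ x in (0 : ℝ)..|r|, (A y x - A w x) := by
        rw [intervalIntegral.integral_sub
          (intervalIntegrable_of_abs_le_exp (hNl y) hl (hAc y) (hAb y) (abs_nonneg r))
          (intervalIntegrable_of_abs_le_exp (hNl w) hl (hAc w) (hAb w) (abs_nonneg r))]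
        simp only [hT, BoundedContinuousFunction.coe_ofNormedAddCommGroup]
        ring
      have h2 := abs_integral_le_of_abs_le_exp (M := Q * dist y w / l) (by positivity) hl
        (hsub y w) (abs_nonneg r)
      rw [Real.dist_eq, h1, abs_mul, abs_of_pos (Real.exp_pos _)]
      calc _ ≤ Real.exp (-(l * |r|)) * (Q * dist y w / l / l * Real.exp (l * |r|)) :=
            mul_le_mul_of_nonneg_left h2 (Real.exp_pos _).le
        _ = Q * dist y w / l / l * (Real.exp (-(l * |r|)) * Real.exp (l * |r|)) := by ring
        _ = _ := by rw [hexp]; field_simp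
  obtain ⟨y, hy⟩ : ∃ y, T y = y := ⟨_, hcontr.fixedPoint_isFixedPt⟩
  have hy' : ∀ r, Real.exp (l * |r|) * y r = a + ∫ x in (0 : ℝ)..|r|, A y x := by
    intro r
    have h1 : Real.exp (-(l * |r|)) * (a + ∫ x in (0 : ℝ)..|r|, A y x) = y r :=
      congrArg (fun w : ℝ →ᵇ ℝ => w r) hy
    rw [← h1, ← mul_assoc, mul_comm (Real.exp _), hexp, one_mul]
  refine ⟨fun r => a + ∫ x in (0 : ℝ)..|r|, A y x, A y, N y / l, hNl y, hcont y, by simp,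
    fun r hr => ?_, fun r hr => ?_, hAb y⟩
  · have h1 : HasDerivAt (fun r => ∫ x in (0 : ℝ)..r, A y x) (A y r) r :=
      intervalIntegral.integral_hasDerivAt_right
        (intervalIntegrable_of_abs_le_exp (hNl y) hl (hAc y) (hAb y) hr.le)
        ((hAc y).stronglyMeasurableAtFilter isOpen_Ioi r hr)
        ((hAc y).continuousAt (Ioi_mem_nhds hr))
    refine (h1.const_add a).congr_of_eventuallyEq ?_
    filter_upwards [Ioi_mem_nhds hr] with x hx
    rw [abs_of_pos hx]
  · have h1 := hasDerivAt_mul_weightedPrimitive hWc hWp hWm (hN0 y) hl (hSc y) (hSb y) hr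
    refine h1.congr_deriv ?_
    simp only [← hy']
    simp only [hS, volterraSource, abs_of_pos hr]

end WeightedVolterraEquation

/-! ### Sign and comparison arguments. -/

theorem nonneg_of_hasDerivAt_of_tendsto_zero {E E' : ℝ → ℝ} {ρ : ℝ}
    (hd : ∀ r ∈ Set.Ioc 0 ρ, HasDerivAt E (E' r) r) (hE' : ∀ r ∈ Set.Ioc 0 ρ, 0 ≤ E' r)
    (h0 : Tendsto E (𝓝[>] 0) (𝓝 0)) : ∀ r ∈ Set.Ioc 0 ρ, 0 ≤ E r := by
  have hm : MonotoneOn E (Set.Ioc 0 ρ) := by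
    apply monotoneOn_of_deriv_nonneg (convex_Ioc 0 ρ)
    · exact fun y hy => (hd y hy).continuousAt.continuousWithinAt
    · exact fun y hy => (hd y (interior_subset hy)).differentiableAt.differentiableWithinAt
    · intro y hy
      rw [(hd y (interior_subset hy)).deriv]
      exact hE' y (interior_subset hy)
  intro r hr
  refine le_of_tendsto h0 ?_
  filter_upwards [Ioc_mem_nhdsGT hr.1] with x hx
  exact hm ⟨hx.1, hx.2.trans hr.2⟩ hr hx.2

theorem tendsto_weight_mul_zero {W z u : ℝ → ℝ} {M l : ℝ} (hW0 : Tendsto W (𝓝[>] 0) (𝓝 0))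
    (hu : Continuous u) (hz : ∀ r > 0, |z r| ≤ M * Real.exp (l * r)) :
    Tendsto (fun r => W r * z r * u r) (𝓝[>] 0) (𝓝 0) := by
  have h1 : Tendsto (fun r => |W r| * (M * Real.exp (l * r) * |u r|)) (𝓝[>] 0) (𝓝 0) := by
    have h2 : Continuous fun r => M * Real.exp (l * r) * |u r| := by fun_prop
    simpa using hW0.abs.mul (h2.continuousAt.tendsto.mono_left (nhdsWithin_le_nhds (s := Set.Ioi 0)))
  refine squeeze_zero_norm' ?_ h1
  filter_upwards [self_mem_nhdsWithin] with r hr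
  rw [Real.norm_eq_abs, abs_mul, abs_mul, mul_assoc]
  gcongr
  exact hz r hr

/-- The solution of the homogeneous equation with value `1` at `0` is positive. -/
theorem homogeneous_solution_pos {W q u z : ℝ → ℝ} {M l : ℝ} (hWp : ∀ r > 0, 0 < W r)
    (hq : ∀ r > 0, 0 ≤ q r) (hW0 : Tendsto W (𝓝[>] 0) (𝓝 0)) (hu : Continuous u) (hu0 : u 0 = 1)
    (hd : ∀ r > 0, HasDerivAt u (z r) r)
    (hdz : ∀ r > 0, HasDerivAt (fun r => W r * z r) (W r * (q r * u r)) r)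
    (hz : ∀ r > 0, |z r| ≤ M * Real.exp (l * r)) {r : ℝ} (hr : 0 ≤ r) : 0 < u r := by
  -- This product has derivative `W (q u² + z²) ≥ 0` and tends to 0 at 0. Hence `u u' ≥ 0`, so `u²`
  -- never falls below its initial value 1 and `u` cannot change sign.
  have hE : ∀ r > 0, 0 ≤ W r * z r * u r := by
    intro r hr
    refine nonneg_of_hasDerivAt_of_tendsto_zero (ρ := r) (E := fun r => W r * z r * u r)
      (fun x hx => (hdz x hx.1).mul (hd x hx.1)) (fun x hx => ?_)
      (tendsto_weight_mul_zero hW0 hu hz) r ⟨hr, le_rfl⟩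
    have h1 : W x * (q x * u x) * u x + W x * z x * z x = W x * (q x * u x ^ 2 + z x ^ 2) := by
      ring
    rw [h1]
    have := (hWp x hx.1).le
    have := hq x hx.1
    positivity
  have hm : MonotoneOn (fun r => u r ^ 2) (Set.Ici 0) := by
    have hd2 : ∀ x ∈ interior (Set.Ici (0 : ℝ)),
        HasDerivAt (fun r => u r ^ 2) (2 * u x * z x) x := by
      intro x hx
      rw [interior_Ici] at hx
      exact ((hd x hx).pow 2).congr_deriv (by simp)
    refine monotoneOn_of_deriv_nonneg (convex_Ici 0) (hu.pow 2).continuousOn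
      (fun x hx => (hd2 x hx).differentiableAt.differentiableWithinAt) fun x hx => ?_
    rw [(hd2 x hx).deriv]
    rw [interior_Ici] at hx
    have h1 := hE x hx
    rw [mul_assoc] at h1
    have := nonneg_of_mul_nonneg_right h1 (hWp x hx)
    linarith
  by_contra hneg
  obtain ⟨x, hx, hx0⟩ := intermediate_value_Icc' hr hu.continuousOn
    (show (0 : ℝ) ∈ Set.Icc (u r) (u 0) from ⟨not_lt.1 hneg, by rw [hu0]; exact zero_le_one⟩)
  have := hm (Set.mem_Ici.2 le_rfl) (Set.mem_Ici.2 hx.1) hx.1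
  simp only [hx0, hu0] at this
  norm_num at this

/-- The quotient of a solution of the inhomogeneous equation by a positive solution of the
homogeneous one is non-increasing. -/
theorem antitoneOn_quotient {W q g u₁ z₁ u₂ z₂ : ℝ → ℝ} {M₁ M₂ l : ℝ} (hWp : ∀ r > 0, 0 < W r)
    (hW0 : Tendsto W (𝓝[>] 0) (𝓝 0)) (hg : ∀ r > 0, 0 ≤ g r)
    (hu₁ : Continuous u₁) (hu₂ : Continuous u₂) (hpos : ∀ r > 0, 0 < u₁ r)
    (hd₁ : ∀ r > 0, HasDerivAt u₁ (z₁ r) r) (hd₂ : ∀ r > 0, HasDerivAt u₂ (z₂ r) r)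
    (hdz₁ : ∀ r > 0, HasDerivAt (fun r => W r * z₁ r) (W r * (q r * u₁ r)) r)
    (hdz₂ : ∀ r > 0, HasDerivAt (fun r => W r * z₂ r) (W r * (q r * u₂ r - g r)) r)
    (hz₁ : ∀ r > 0, |z₁ r| ≤ M₁ * Real.exp (l * r))
    (hz₂ : ∀ r > 0, |z₂ r| ≤ M₂ * Real.exp (l * r)) :
    AntitoneOn (fun r => u₂ r / u₁ r) (Set.Ioi 0) := by
  -- The weighted Wronskian: the terms in `q` and `z₁ z₂` cancel in its derivative, leaving `W g u₁
  -- ≥ 0`.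
  have hE : ∀ r > 0, 0 ≤ W r * z₁ r * u₂ r - W r * z₂ r * u₁ r := by
    intro r hr
    refine nonneg_of_hasDerivAt_of_tendsto_zero (ρ := r)
      (E := fun r => W r * z₁ r * u₂ r - W r * z₂ r * u₁ r)
      (fun x hx => ((hdz₁ x hx.1).mul (hd₂ x hx.1)).sub ((hdz₂ x hx.1).mul (hd₁ x hx.1)))
      (fun x hx => ?_) ?_ r ⟨hr, le_rfl⟩
    · have h1 : W x * (q x * u₁ x) * u₂ x + W x * z₁ x * z₂ x
          - (W x * (q x * u₂ x - g x) * u₁ x + W x * z₂ x * z₁ x) = W x * g x * u₁ x := by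
        ring
      rw [h1]
      exact mul_nonneg (mul_nonneg (hWp x hx.1).le (hg x hx.1)) (hpos x hx.1).le
    · simpa using (tendsto_weight_mul_zero hW0 hu₂ hz₁).sub (tendsto_weight_mul_zero hW0 hu₁ hz₂)
  have hdq : ∀ x > 0, HasDerivAt (fun r => u₂ r / u₁ r)
      ((z₂ x * u₁ x - u₂ x * z₁ x) / u₁ x ^ 2) x := fun x hx =>
    (hd₂ x hx).div (hd₁ x hx) (hpos x hx).ne'
  refine antitoneOn_of_deriv_nonpos (convex_Ioi 0)
    (fun x hx => (hdq x hx).continuousAt.continuousWithinAt)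
    (fun x hx => (hdq x (interior_subset hx)).differentiableAt.differentiableWithinAt)
    fun x hx => ?_
  have hx' := interior_subset hx
  rw [(hdq x hx').deriv]
  refine div_nonpos_of_nonpos_of_nonneg ?_ (sq_nonneg _)
  have h1 : W x * z₁ x * u₂ x - W x * z₂ x * u₁ x = W x * -(z₂ x * u₁ x - u₂ x * z₁ x) := by ring
  have h2 := nonneg_of_mul_nonneg_right (h1 ▸ hE x hx') (hWp x hx')
  linarith

/-! ### The weight and potential of the transformed equation. -/

theorem hasDerivAt_rpow_of_pos {r : ℝ} (p : ℝ) (hr : 0 < r) :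
    HasDerivAt (fun x : ℝ => x ^ p) (p * r ^ p / r) r := by
  refine (Real.hasDerivAt_rpow_const (Or.inl hr.ne')).congr_deriv ?_
  rw [Real.rpow_sub_one hr.ne']
  ring

/-- The weight `r^(-2γ) sn(r)^(n-1)`. -/
noncomputable def radialWeight (n : ℕ) (c γ r : ℝ) : ℝ := r ^ (-2 * γ) * sn c r ^ (n - 1)

/-- The potential `(n-1) γ (ct(r) - 1/r) / r`. -/
noncomputable def radialPotential (n : ℕ) (c γ r : ℝ) : ℝ :=
  ((n : ℝ) - 1) * γ * (ct c r - 1 / r) / r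

section Radial

variable {n : ℕ} {c γ : ℝ}

theorem hasDerivAt_sn_pow (hn : 3 ≤ n) (hc : c ≤ 0) {r : ℝ} (hr : 0 < r) :
    HasDerivAt (fun x => sn c x ^ (n - 1)) (((n : ℝ) - 1) * ct c r * sn c r ^ (n - 1)) r := by
  refine ((hasDerivAt_sn hc hr).pow (n - 1)).congr_deriv ?_
  obtain ⟨k, rfl⟩ : ∃ k, n = k + 2 := ⟨n - 2, by omega⟩
  simp only [Nat.add_sub_cancel, show k + 2 - 1 = k + 1 from rfl]
  push_cast
  ring

theorem radialWeight_pos (hc : c ≤ 0) {r : ℝ} (hr : 0 < r) : 0 < radialWeight n c γ r :=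
  mul_pos (Real.rpow_pos_of_pos hr _) (pow_pos (sn_pos hc hr) _)

theorem hasDerivAt_radialWeight (hn : 3 ≤ n) (hc : c ≤ 0) {r : ℝ} (hr : 0 < r) :
    HasDerivAt (radialWeight n c γ)
      (radialWeight n c γ r * (((n : ℝ) - 1) * ct c r - 2 * γ / r)) r := by
  refine ((hasDerivAt_rpow_of_pos (-2 * γ) hr).mul (hasDerivAt_sn_pow hn hc hr)).congr_deriv ?_
  simp only [radialWeight]
  ring

theorem continuousOn_radialWeight (hn : 3 ≤ n) (hc : c ≤ 0) :
    ContinuousOn (radialWeight n c γ) (Set.Ioi 0) := fun _ hr =>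
  (hasDerivAt_radialWeight hn hc hr).continuousAt.continuousWithinAt

theorem monotoneOn_radialWeight (hn : 3 ≤ n) (hc : c ≤ 0) (hγ : 2 * γ ≤ (n : ℝ) - 1) :
    MonotoneOn (radialWeight n c γ) (Set.Ioi 0) := by
  refine monotoneOn_of_deriv_nonneg (convex_Ioi 0) (continuousOn_radialWeight hn hc)
    (fun x hx => (hasDerivAt_radialWeight hn hc
      (interior_subset hx)).differentiableAt.differentiableWithinAt) fun x hx => ?_
  have hx' : 0 < x := interior_subset hx
  rw [(hasDerivAt_radialWeight hn hc hx').deriv]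
  refine mul_nonneg (radialWeight_pos hc hx').le ?_
  have hn' : (3 : ℝ) ≤ n := by exact_mod_cast hn
  have h1 := mul_le_mul_of_nonneg_left (inv_le_ct hc hx') (by linarith : 0 ≤ (n : ℝ) - 1)
  have h2 : 2 * γ / x ≤ ((n : ℝ) - 1) * (1 / x) := by
    rw [mul_one_div]
    gcongr
  linarith

theorem exists_radialWeight_le (hc : c ≤ 0) (hn : 3 ≤ n) {ρ : ℝ} (hρ : 0 < ρ) :
    ∃ C, 0 < C ∧ ∀ r ∈ Set.Ioc 0 ρ, radialWeight n c γ r ≤ C * r ^ ((n : ℝ) - 1 - 2 * γ) := by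
  obtain ⟨C, hC, h⟩ := exists_sn_le hc hρ
  refine ⟨C ^ (n - 1), by positivity, fun r hr => ?_⟩
  have h1 : sn c r ^ (n - 1) ≤ (C * r) ^ (n - 1) := pow_le_pow_left₀ (sn_pos hc hr.1).le (h r hr) _
  have h2 : r ^ ((n : ℝ) - 1 - 2 * γ) = r ^ (-2 * γ) * r ^ (n - 1) := by
    rw [← Real.rpow_natCast r (n - 1), ← Real.rpow_add hr.1, Nat.cast_sub (by omega)]
    congr 1
    push_cast
    ring
  calc _ ≤ r ^ (-2 * γ) * (C * r) ^ (n - 1) :=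
        mul_le_mul_of_nonneg_left h1 (Real.rpow_pos_of_pos hr.1 _).le
    _ = _ := by rw [h2, mul_pow]; ring

theorem tendsto_rpow_nhdsGT_zero {p : ℝ} (hp : 0 < p) :
    Tendsto (fun r : ℝ => r ^ p) (𝓝[>] 0) (𝓝 0) := by
  have := (Real.continuous_rpow_const hp.le).tendsto 0
  rw [Real.zero_rpow hp.ne'] at this
  exact this.mono_left nhdsWithin_le_nhds

theorem tendsto_radialWeight (hc : c ≤ 0) (hn : 3 ≤ n) (hγ : 2 * γ < (n : ℝ) - 1) :
    Tendsto (radialWeight n c γ) (𝓝[>] 0) (𝓝 0) := by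
  obtain ⟨C, hC, h⟩ := exists_radialWeight_le (γ := γ) hc hn one_pos
  have h1 : Tendsto (fun r : ℝ => C * r ^ ((n : ℝ) - 1 - 2 * γ)) (𝓝[>] 0) (𝓝 0) := by
    simpa using (tendsto_rpow_nhdsGT_zero (by linarith : 0 < (n : ℝ) - 1 - 2 * γ)).const_mul C
  refine squeeze_zero' ?_ ?_ h1
  · filter_upwards [self_mem_nhdsWithin] with r hr using (radialWeight_pos hc hr).le
  · filter_upwards [Ioc_mem_nhdsGT one_pos] with r hr using h r hr

theorem radialPotential_nonneg (hn : 3 ≤ n) (hc : c ≤ 0) (hγ : 0 ≤ γ) {r : ℝ} (hr : 0 < r) :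
    0 ≤ radialPotential n c γ r := by
  have hn' : (3 : ℝ) ≤ n := by exact_mod_cast hn
  have := inv_le_ct hc hr
  exact div_nonneg (mul_nonneg (mul_nonneg (by linarith) hγ) (by linarith)) hr.le

theorem radialPotential_le (hn : 3 ≤ n) (hc : c ≤ 0) (hγ : 0 ≤ γ) {r : ℝ} (hr : 0 < r) :
    radialPotential n c γ r ≤ ((n : ℝ) - 1) * γ * (-c) := by
  have hn' : (3 : ℝ) ≤ n := by exact_mod_cast hn
  have h1 := ct_le_inv_add hc hr
  rw [radialPotential, div_le_iff₀ hr, mul_assoc _ (-c) r]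
  exact mul_le_mul_of_nonneg_left (by linarith) (mul_nonneg (by linarith) hγ)

theorem continuousOn_radialPotential (hc : c ≤ 0) :
    ContinuousOn (radialPotential n c γ) (Set.Ioi 0) := by
  unfold radialPotential
  refine ContinuousOn.div (continuousOn_const.mul ((contDiffOn_ct hc).continuousOn.sub
    (continuousOn_const.div continuousOn_id fun x hx => ne_of_gt hx))) continuousOn_id
    fun x hx => ne_of_gt hx

end Radial

/-! ### Existence, energy bound and monotonicity. -/

section Radial

variable {n : ℕ} {μ c γ ρ : ℝ}

theorem rpow_le_exp_mul {r l : ℝ} (hr : 0 < r) (hγ : 0 ≤ γ) (hl : γ ≤ l) :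
    r ^ γ ≤ Real.exp (l * r) := by
  rw [Real.rpow_def_of_pos hr]
  refine Real.exp_le_exp.2 ?_
  have h1 : Real.log r ≤ r := (Real.log_le_sub_one_of_pos hr).trans (by linarith)
  calc Real.log r * γ ≤ r * γ := mul_le_mul_of_nonneg_right h1 hγ
    _ ≤ r * l := mul_le_mul_of_nonneg_left hl hr.le
    _ = l * r := mul_comm _ _

theorem exists_transformed_solution (hn : 3 ≤ n) (hc : c ≤ 0) (hγ : 0 ≤ γ)
    (hγn : 2 * γ < (n : ℝ) - 2) (hρ : 0 < ρ) :
    ∃ (u z : ℝ → ℝ) (M : ℝ), Continuous u ∧ u ρ = 0 ∧ (∀ r ∈ Set.Ioc 0 ρ, 0 ≤ u r) ∧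
      (∀ r > 0, HasDerivAt u (z r) r) ∧
      (∀ r > 0, HasDerivAt (fun r => radialWeight n c γ r * z r)
        (radialWeight n c γ r * (radialPotential n c γ r * u r - r ^ γ)) r) ∧
      ∀ r ∈ Set.Ioc 0 ρ, |z r| ≤ M := by
  have hn' : (3 : ℝ) ≤ n := by exact_mod_cast hn
  set Q := ((n : ℝ) - 1) * γ * (-c) with hQ
  have hQ0 : 0 ≤ Q := mul_nonneg (mul_nonneg (by linarith) hγ) (by linarith)
  -- Large enough both for `r^γ ≤ e^(l r)`, which needs `γ ≤ l`, and for the contraction condition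
  -- `Q < l²`.
  set l := γ + Q + 1 with hl
  have hl0 : 0 < l := by linarith
  have hlQ : Q < l ^ 2 := by nlinarith
  have hWp : ∀ r > 0, 0 < radialWeight n c γ r := fun r hr => radialWeight_pos hc hr
  have hWc := continuousOn_radialWeight (γ := γ) hn hc
  have hWm : MonotoneOn (radialWeight n c γ) _ :=
    monotoneOn_radialWeight hn hc (by linarith)
  have hW0 : Tendsto (radialWeight n c γ) _ _ := tendsto_radialWeight hc hn (by linarith)
  have hq : ∀ r > 0, 0 ≤ radialPotential n c γ r := fun r hr => radialPotential_nonneg hn hc hγ hr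
  have hqQ : ∀ r > 0, radialPotential n c γ r ≤ Q := fun r hr => radialPotential_le hn hc hγ hr
  have hqc := continuousOn_radialPotential (n := n) (γ := γ) hc
  obtain ⟨u₁, z₁, M₁, hM₁, hu₁, hu₁0, hd₁, hdz₁, hz₁⟩ :=
    exists_weighted_volterra_solution (g := fun _ => 0) (G := 0) hWc hWp hWm hqc hq hqQ
      continuousOn_const le_rfl (by simp) hl0 hlQ 1
  obtain ⟨u₂, z₂, M₂, hM₂, hu₂, hu₂0, hd₂, hdz₂, hz₂⟩ :=
    exists_weighted_volterra_solution (g := fun r => r ^ γ) (G := 1) hWc hWp hWm hqc hq hqQ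
      (Real.continuous_rpow_const hγ).continuousOn zero_le_one (fun r hr => by
        rw [abs_of_pos (Real.rpow_pos_of_pos hr _), one_mul]
        exact rpow_le_exp_mul hr hγ (by linarith)) hl0 hlQ 0
  simp only [sub_zero] at hdz₁
  have hpos : ∀ r ≥ 0, 0 < u₁ r := fun r hr =>
    homogeneous_solution_pos hWp hq hW0 hu₁ hu₁0 hd₁ hdz₁ hz₁ hr
  have hanti := antitoneOn_quotient (g := fun r => r ^ γ) hWp hW0
    (fun r hr => (Real.rpow_pos_of_pos hr _).le) hu₁ hu₂
    (fun r hr => hpos r (le_of_lt hr)) hd₁ hd₂ hdz₁ hdz₂ hz₁ hz₂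
  set k := u₂ ρ / u₁ ρ with hk
  refine ⟨fun r => u₂ r - k * u₁ r, fun r => z₂ r - k * z₁ r,
    (M₂ + |k| * M₁) * Real.exp (l * ρ), by fun_prop, ?_, fun r hr => ?_, fun r hr => ?_,
    fun r hr => ?_, fun r hr => ?_⟩
  · have := (hpos ρ hρ.le).ne'
    simp only [hk]
    field_simp
    simp
  -- Here `u = u₁ (u₂/u₁ - k)`, where `k` is the value at `ρ` of the non-increasing quotient.
  · have h1 := hanti hr.1 hρ hr.2
    simp only [← hk, le_div_iff₀ (hpos r hr.1.le)] at h1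
    linarith
  · exact (hd₂ r hr).sub ((hd₁ r hr).const_mul k)
  · refine (((hdz₂ r hr).sub ((hdz₁ r hr).const_mul k)).congr_of_eventuallyEq
      (.of_forall fun x => ?_)).congr_deriv ?_
    · simp only [Pi.sub_apply]
      ring
    · ring
  · have he : Real.exp (l * r) ≤ Real.exp (l * ρ) :=
      Real.exp_le_exp.2 (mul_le_mul_of_nonneg_left hr.2 hl0.le)
    calc _ ≤ |z₂ r| + |k * z₁ r| := abs_sub _ _
      _ ≤ M₂ * Real.exp (l * r) + |k| * (M₁ * Real.exp (l * r)) := by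
          rw [abs_mul]
          exact add_le_add (hz₂ r hr.1) (mul_le_mul_of_nonneg_left (hz₁ r hr.1) (abs_nonneg _))
      _ = (M₂ + |k| * M₁) * Real.exp (l * r) := by ring
      _ ≤ _ := mul_le_mul_of_nonneg_left he (by positivity)

theorem exists_bounded_singularity_solution (hn : 3 ≤ n) (hc : c ≤ 0) (hγ : 0 ≤ γ)
    (hγn : 2 * γ < (n : ℝ) - 2) (hμ : μ = γ * ((n : ℝ) - 2) - γ ^ 2) (hρ : 0 < ρ) :
    ∃ (f f₁ : ℝ → ℝ) (K : ℝ), f ρ = 0 ∧ (∀ r ∈ Set.Ioc 0 ρ, 0 ≤ f r) ∧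
      (∀ r > 0, HasDerivAt f (f₁ r) r) ∧
      (∀ r > 0, HasDerivAt f₁ (-(((n : ℝ) - 1) * f₁ r * ct c r) - μ * (f r / r ^ 2) - 1) r) ∧
      ∀ r ∈ Set.Ioc 0 ρ, |f₁ r| ≤ K * r ^ (-γ - 1) := by
  obtain ⟨u, z, M, hu, huρ, hu0, hd, hdz, hz⟩ := exists_transformed_solution hn hc hγ hγn hρ
  obtain ⟨B, hB⟩ := (isCompact_Icc (a := (0 : ℝ)) (b := ρ)).exists_bound_of_continuousOn
    hu.continuousOn
  have hdz' : ∀ r > 0, HasDerivAt z (radialPotential n c γ r * u r - r ^ γ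
      - (((n : ℝ) - 1) * ct c r - 2 * γ / r) * z r) r := by
    intro r hr
    have hW := (radialWeight_pos (n := n) (γ := γ) hc hr).ne'
    have h1 := (hdz r hr).div (hasDerivAt_radialWeight (γ := γ) hn hc hr) hW
    refine (h1.congr_of_eventuallyEq ?_).congr_deriv ?_
    · filter_upwards [Ioi_mem_nhds hr] with x hx
      simp only [Pi.div_apply]
      rw [mul_div_cancel_left₀ _ (radialWeight_pos hc hx).ne']
    · generalize radialWeight n c γ r = W at hW
      field_simp
  -- The constant bounds `|r u' - γ u|` on `(0, ρ]`, because `f' = r^(-γ-1) (r u' - γ u)`.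
  refine ⟨fun r => r ^ (-γ) * u r, fun r => r ^ (-γ) * (z r - γ * u r / r), M * ρ + γ * B,
    by simp [huρ], fun r hr => mul_nonneg (Real.rpow_pos_of_pos hr.1 _).le (hu0 r hr),
    fun r hr => ?_, fun r hr => ?_, fun r hr => ?_⟩
  · refine ((hasDerivAt_rpow_of_pos (-γ) hr).mul (hd r hr)).congr_deriv ?_
    ring
  · have h1 := (hasDerivAt_rpow_of_pos (-γ) hr).mul ((hdz' r hr).sub
      (((hd r hr).const_mul γ).div (hasDerivAt_id r) hr.ne'))
    refine h1.congr_deriv ?_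
    have h2 : r ^ γ = (r ^ (-γ))⁻¹ := by rw [Real.rpow_neg hr.le, inv_inv]
    have h3 : r ^ (-γ) ≠ 0 := (Real.rpow_pos_of_pos hr _).ne'
    simp only [radialPotential, h2, hμ, id, Pi.sub_apply, Pi.div_apply]
    generalize r ^ (-γ) = p at h3
    field_simp
    ring
  · have hr0 : 0 < r := hr.1
    have h1 : r ^ (-γ - 1) = r ^ (-γ) / r := Real.rpow_sub_one hr0.ne' _
    have hp := Real.rpow_pos_of_pos hr0 (-γ)
    have h2 : z r - γ * u r / r = (z r * r - γ * u r) / r := by field_simp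
    rw [h1, abs_mul, abs_of_pos hp, h2, abs_div, abs_of_pos hr0]
    have h3 : |z r * r - γ * u r| ≤ M * ρ + γ * B := by
      refine (abs_sub _ _).trans (add_le_add ?_ ?_)
      · rw [abs_mul, abs_of_pos hr0]
        exact mul_le_mul (hz r hr) hr.2 hr0.le ((abs_nonneg _).trans (hz r hr))
      · rw [abs_mul, abs_of_nonneg hγ]
        exact mul_le_mul_of_nonneg_left (hB r ⟨hr0.le, hr.2⟩) hγ
    calc _ ≤ r ^ (-γ) * ((M * ρ + γ * B) / r) := by gcongr
      _ = _ := by ring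

theorem integrableOn_sq_mul_pow {f₁ : ℝ → ℝ} {K : ℝ} (hn : 3 ≤ n) (hγn : 2 * γ < (n : ℝ) - 2)
    (hρ : 0 < ρ) (hc : ContinuousOn f₁ (Set.Ioc 0 ρ))
    (hK : ∀ r ∈ Set.Ioc 0 ρ, |f₁ r| ≤ K * r ^ (-γ - 1)) :
    MeasureTheory.IntegrableOn (fun r => f₁ r ^ 2 * r ^ (n - 1)) (Set.Ioc 0 ρ) := by
  -- The exponent exceeds `-1` exactly when `2γ < n-2`.
  have h1 : MeasureTheory.IntegrableOn (fun r : ℝ => K ^ 2 * r ^ ((n : ℝ) - 3 - 2 * γ))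
      (Set.Ioc 0 ρ) := by
    rw [← intervalIntegrable_iff_integrableOn_Ioc_of_le hρ.le]
    exact (intervalIntegral.intervalIntegrable_rpow' (by linarith)).const_mul _
  refine h1.mono' ?_ ?_
  · exact ((hc.pow 2).mul (continuous_pow _).continuousOn).aestronglyMeasurable measurableSet_Ioc
  · refine (MeasureTheory.ae_restrict_iff' measurableSet_Ioc).2 (.of_forall fun r hr => ?_)
    have hr0 : 0 < r := hr.1
    have h2 : r ^ ((n : ℝ) - 3 - 2 * γ) = (r ^ (-γ - 1)) ^ 2 * r ^ (n - 1) := by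
      rw [← Real.rpow_natCast r (n - 1), ← Real.rpow_natCast _ 2, ← Real.rpow_mul hr0.le,
        ← Real.rpow_add hr0, Nat.cast_sub (by omega)]
      congr 1
      push_cast
      ring
    rw [h2, Real.norm_eq_abs, abs_mul, abs_pow, abs_of_pos (pow_pos hr0 _), ← mul_assoc, ← mul_pow]
    have := hK r hr
    gcongr

/-- In divergence form `(sn^(n-1) f')' = -sn^(n-1) (μ f/r² + 1) ≤ 0`. The flux `sn^(n-1) f'` is
`O(r^(n-2-γ))`, so it starts from 0. -/
theorem deriv_nonpos_of_nonneg_solution {f f₁ : ℝ → ℝ} {K : ℝ} (hn : 3 ≤ n) (hc : c ≤ 0)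
    (hγ : 0 ≤ γ) (hγn : 2 * γ < (n : ℝ) - 2) (hμ : 0 ≤ μ) (hρ : 0 < ρ)
    (hf : ∀ r ∈ Set.Ioc 0 ρ, 0 ≤ f r)
    (hd : ∀ r > 0, HasDerivAt f₁ (-(((n : ℝ) - 1) * f₁ r * ct c r) - μ * (f r / r ^ 2) - 1) r)
    (hK : ∀ r ∈ Set.Ioc 0 ρ, |f₁ r| ≤ K * r ^ (-γ - 1)) : ∀ r ∈ Set.Ioc 0 ρ, f₁ r ≤ 0 := by
  have h0 : Tendsto (fun r => -(sn c r ^ (n - 1) * f₁ r)) (𝓝[>] 0) (𝓝 0) := by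
    -- With exponent 0 the weight is just `sn^(n-1)`.
    obtain ⟨C, hC, h⟩ := exists_radialWeight_le (γ := 0) hc hn hρ
    have h1 : Tendsto (fun r : ℝ => C * K * r ^ ((n : ℝ) - 2 - γ)) (𝓝[>] 0) (𝓝 0) := by
      simpa using (tendsto_rpow_nhdsGT_zero (by linarith : 0 < (n : ℝ) - 2 - γ)).const_mul (C * K)
    refine squeeze_zero_norm' ?_ h1
    filter_upwards [Ioc_mem_nhdsGT hρ] with r hr
    have h2 := h r hr
    simp only [radialWeight, mul_zero, Real.rpow_zero, one_mul, sub_zero] at h2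
    have h3 : r ^ ((n : ℝ) - 2 - γ) = r ^ ((n : ℝ) - 1) * r ^ (-γ - 1) := by
      rw [← Real.rpow_add hr.1]
      congr 1
      ring
    rw [norm_neg, Real.norm_eq_abs, abs_mul, abs_of_pos (pow_pos (sn_pos hc hr.1) _), h3]
    calc _ ≤ C * r ^ ((n : ℝ) - 1) * (K * r ^ (-γ - 1)) :=
          mul_le_mul h2 (hK r hr) (abs_nonneg _)
            (mul_nonneg hC.le (Real.rpow_pos_of_pos hr.1 _).le)
      _ = _ := by ring
  intro r hr
  have h1 := nonneg_of_hasDerivAt_of_tendsto_zero (ρ := ρ)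
    (E := fun r => -(sn c r ^ (n - 1) * f₁ r)) (fun x hx => ((hasDerivAt_sn_pow hn hc hx.1).mul (hd x hx.1)).neg) (fun x hx => ?_) h0 r hr
  · have h2 : -(sn c r ^ (n - 1) * f₁ r) = sn c r ^ (n - 1) * -f₁ r := by ring
    have := nonneg_of_mul_nonneg_right (h2 ▸ h1) (pow_pos (sn_pos hc hr.1) _)
    linarith
  · have h2 := hf x hx
    have h3 := pow_pos (sn_pos hc hx.1) (n - 1)
    have h4 : 0 ≤ sn c x ^ (n - 1) * (μ * (f x / x ^ 2) + 1) := by positivity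
    linarith

end Radial

/-! ### Uniqueness in the energy class. -/

section Radial

variable {n : ℕ} {μ c γ ρ : ℝ}

/-- A solution of the homogeneous equation with finite energy and value `0` at `ρ` vanishes. -/
theorem homogeneous_solution_eq_zero {h h₁ : ℝ → ℝ} (hn : 3 ≤ n) (hc : c ≤ 0) (hγ : 0 ≤ γ)
    (hγn : 2 * γ < (n : ℝ) - 2) (hμ : μ = γ * ((n : ℝ) - 2) - γ ^ 2) (hρ : 0 < ρ)
    (hh : ContinuousOn h (Set.Ioc 0 ρ)) (hh₁ : ContinuousOn h₁ (Set.Ioc 0 ρ))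
    (hd : ∀ r ∈ Set.Ioo 0 ρ, HasDerivAt h (h₁ r) r)
    (hd₁ : ∀ r ∈ Set.Ioo 0 ρ,
      HasDerivAt h₁ (-(((n : ℝ) - 1) * h₁ r * ct c r) - μ * (h r / r ^ 2)) r)
    (hhρ : h ρ = 0)
    (hE : MeasureTheory.IntegrableOn (fun r => h₁ r ^ 2 * r ^ (n - 1)) (Set.Ioc 0 ρ)) :
    ∀ r ∈ Set.Ioc 0 ρ, h r = 0 := by
  have hn' : (3 : ℝ) ≤ n := by exact_mod_cast hn
  set W := radialWeight n c γ with hW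
  set q := radialPotential n c γ with hq
  set v : ℝ → ℝ := fun r => r ^ γ * h r with hv
  set v₁ : ℝ → ℝ := fun r => r ^ γ * (h₁ r + γ * h r / r) with hv₁
  have hWp : ∀ r > 0, 0 < W r := fun r hr => radialWeight_pos hc hr
  have hWc : ContinuousOn W (Set.Ioc 0 ρ) :=
    (continuousOn_radialWeight hn hc).mono Set.Ioc_subset_Ioi_self
  have hpc : ContinuousOn (fun r : ℝ => r ^ γ) (Set.Ioc 0 ρ) :=
    (Real.continuous_rpow_const hγ).continuousOn
  have hvc : ContinuousOn v (Set.Ioc 0 ρ) := hpc.mul hh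
  have hv₁c : ContinuousOn v₁ (Set.Ioc 0 ρ) :=
    hpc.mul (hh₁.add ((continuousOn_const.mul hh).div continuousOn_id fun x hx => hx.1.ne'))
  have hdv : ∀ r ∈ Set.Ioo 0 ρ, HasDerivAt v (v₁ r) r := by
    intro r hr
    refine ((hasDerivAt_rpow_of_pos γ hr.1).mul (hd r hr)).congr_deriv ?_
    simp only [hv₁]
    ring
  have hdWv : ∀ r ∈ Set.Ioo 0 ρ, HasDerivAt (fun r => W r * v₁ r) (W r * (q r * v r)) r := by
    intro r hr
    have hr0 : r ≠ 0 := hr.1.ne'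
    have h1 := (hasDerivAt_radialWeight (γ := γ) hn hc hr.1).mul
      ((hasDerivAt_rpow_of_pos γ hr.1).mul
        ((hd₁ r hr).add (((hd r hr).const_mul γ).div (hasDerivAt_id r) hr0)))
    refine h1.congr_deriv ?_
    simp only [hv, hW, hq, radialPotential, hμ, id, Pi.add_apply, Pi.div_apply, Pi.mul_apply]
    generalize radialWeight n c γ r = w
    generalize r ^ γ = p
    field_simp
    ring
  have hq0 : ∀ r > 0, 0 ≤ q r := fun r hr => radialPotential_nonneg hn hc hγ hr
  have hm : MonotoneOn (fun r => W r * v₁ r * v r) (Set.Ioc 0 ρ) := by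
    have hd2 : ∀ r ∈ interior (Set.Ioc 0 ρ), HasDerivAt (fun r => W r * v₁ r * v r)
        (W r * (q r * v r) * v r + W r * v₁ r * v₁ r) r := by
      intro r hr
      rw [interior_Ioc] at hr
      exact (hdWv r hr).mul (hdv r hr)
    refine monotoneOn_of_deriv_nonneg (convex_Ioc 0 ρ) ((hWc.mul hv₁c).mul hvc)
      (fun x hx => (hd2 x hx).differentiableAt.differentiableWithinAt) fun x hx => ?_
    rw [(hd2 x hx).deriv]
    have hx' := interior_subset hx
    have h1 : W x * (q x * v x) * v x + W x * v₁ x * v₁ x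
        = W x * (q x * v x ^ 2 + v₁ x ^ 2) := by ring
    rw [h1]
    have := (hWp x hx'.1).le
    have := hq0 x hx'.1
    positivity
  -- Monotonicity is now used from the right endpoint, where `v` vanishes; nothing is known about
  -- `v` at 0.
  have hneg : ∀ r ∈ Set.Ioc 0 ρ, W r * v₁ r * v r ≤ 0 := by
    intro r hr
    refine (hm hr ⟨hρ, le_rfl⟩ hr.2).trans (le_of_eq ?_)
    simp [hv, hhρ]
  have ha : AntitoneOn (fun r => (W r * v₁ r) ^ 2) (Set.Ioc 0 ρ) := by
    have hd2 : ∀ r ∈ interior (Set.Ioc 0 ρ), HasDerivAt (fun r => (W r * v₁ r) ^ 2)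
        (2 * (W r * v₁ r) * (W r * (q r * v r))) r := by
      intro r hr
      rw [interior_Ioc] at hr
      exact ((hdWv r hr).pow 2).congr_deriv (by simp)
    refine antitoneOn_of_deriv_nonpos (convex_Ioc 0 ρ) ((hWc.mul hv₁c).pow 2)
      (fun x hx => (hd2 x hx).differentiableAt.differentiableWithinAt) fun x hx => ?_
    rw [(hd2 x hx).deriv]
    have hx' := interior_subset hx
    have h1 : 2 * (W x * v₁ x) * (W x * (q x * v x)) = 2 * W x * q x * (W x * v₁ x * v x) := by
      ring
    rw [h1]
    exact mul_nonpos_of_nonneg_of_nonpos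
      (mul_nonneg (by have := hWp x hx'.1; linarith) (hq0 x hx'.1)) (hneg x hx')
  -- A nonzero value at `s` keeps `(W v')²` above `e > 0` on `(0, s]`, and finite energy excludes
  -- this.
  have hzero : ∀ r ∈ Set.Ioc 0 ρ, v₁ r = 0 := by
    intro s hs
    by_contra hne
    have he : 0 < (W s * v₁ s) ^ 2 := by
      have := (hWp s hs.1).ne'
      positivity
    set e := (W s * v₁ s) ^ 2 with he'
    obtain ⟨C, hC, hCW⟩ := exists_radialWeight_le (γ := γ) hc hn hρ
    have hbound : ∀ r ∈ Set.Ioc 0 s,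
        e / C ^ 2 * r ^ (2 * γ - (n : ℝ) + 1) ≤ h₁ r ^ 2 * r ^ (n - 1) := by
      intro r hr
      have hr0 : 0 < r := hr.1
      have hrρ : r ∈ Set.Ioc 0 ρ := ⟨hr.1, hr.2.trans hs.2⟩
      have h1 : e ≤ (W r * v₁ r) ^ 2 := ha hrρ hs hr.2
      -- Since `r^γ h' = v' - (γ/r) v` and `v v' ≤ 0`, the two terms do not cancel.
      have h2 : v₁ r ^ 2 ≤ (r ^ γ) ^ 2 * h₁ r ^ 2 := by
        have h3 : r ^ γ * h₁ r = v₁ r - γ / r * v r := by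
          simp only [hv, hv₁]
          ring
        have h4 : v₁ r * v r ≤ 0 := by
          have := hneg r hrρ
          rw [mul_assoc] at this
          exact nonpos_of_mul_nonpos_right this (hWp r hr0)
        rw [← mul_pow, h3]
        have h5 : 0 ≤ γ / r * -(v₁ r * v r) :=
          mul_nonneg (div_nonneg hγ hr0.le) (by linarith)
        have h6 := sq_nonneg (γ / r * v r)
        linarith [show (v₁ r - γ / r * v r) ^ 2
          = v₁ r ^ 2 + 2 * (γ / r * -(v₁ r * v r)) + (γ / r * v r) ^ 2 by ring]
      have h7 : W r ^ 2 ≤ (C * r ^ ((n : ℝ) - 1 - 2 * γ)) ^ 2 :=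
        pow_le_pow_left₀ (hWp r hr0).le (hCW r hrρ) 2
      have h8 : e ≤ (C * r ^ ((n : ℝ) - 1 - 2 * γ)) ^ 2 * ((r ^ γ) ^ 2 * h₁ r ^ 2) := by
        refine h1.trans ?_
        rw [mul_pow]
        exact mul_le_mul h7 h2 (sq_nonneg _) (sq_nonneg _)
      have h9 : r ^ (n - 1) = r ^ (2 * γ - (n : ℝ) + 1)
          * ((r ^ ((n : ℝ) - 1 - 2 * γ)) ^ 2 * (r ^ γ) ^ 2) := by
        rw [← Real.rpow_natCast r (n - 1), ← Real.rpow_natCast _ 2, ← Real.rpow_natCast _ 2,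
          ← Real.rpow_mul hr0.le, ← Real.rpow_mul hr0.le, ← Real.rpow_add hr0,
          ← Real.rpow_add hr0, Nat.cast_sub (by omega)]
        congr 1
        push_cast
        ring
      have hp := Real.rpow_pos_of_pos hr0 (2 * γ - (n : ℝ) + 1)
      rw [h9, div_mul_eq_mul_div, div_le_iff₀ (by positivity)]
      calc _ ≤ _ := mul_le_mul_of_nonneg_right h8 hp.le
        _ = _ := by ring
    have hint : MeasureTheory.IntegrableOn
        (fun r : ℝ => e / C ^ 2 * r ^ (2 * γ - (n : ℝ) + 1)) (Set.Ioo 0 s) := by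
      refine (hE.mono_set fun x hx => ⟨hx.1, hx.2.le.trans hs.2⟩).mono' ?_ ?_
      · refine ContinuousOn.aestronglyMeasurable (continuousOn_const.mul fun x hx => ?_)
          measurableSet_Ioo
        exact (Real.continuousAt_rpow_const _ _ (Or.inl hx.1.ne')).continuousWithinAt
      · refine (MeasureTheory.ae_restrict_iff' measurableSet_Ioo).2 (.of_forall fun r hr => ?_)
        have := Real.rpow_pos_of_pos hr.1 (2 * γ - (n : ℝ) + 1)
        rw [Real.norm_of_nonneg (by positivity)]
        exact hbound r ⟨hr.1, hr.2.le⟩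
    have hint' : MeasureTheory.IntegrableOn
        (fun r : ℝ => r ^ (2 * γ - (n : ℝ) + 1)) (Set.Ioo 0 s) := by
      have hne' : e / C ^ 2 ≠ 0 := by positivity
      refine (hint.const_mul (e / C ^ 2)⁻¹).congr (.of_forall fun r => ?_)
      simp only
      rw [← mul_assoc, inv_mul_cancel₀ hne', one_mul]
    -- Integrability would force `2γ - n + 1 > -1`, contradicting `2γ < n-2`.
    rw [intervalIntegral.integrableOn_Ioo_rpow_iff hs.1] at hint'
    linarith
  have hconst : ∀ r ∈ Set.Ioc 0 ρ, v r = 0 := by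
    intro r hr
    have hvρ : v ρ = 0 := by simp [hv, hhρ]
    rcases hr.2.eq_or_lt with rfl | hlt
    · exact hvρ
    obtain ⟨x, hx, hxe⟩ := exists_hasDerivAt_eq_slope v v₁ hlt
      (hvc.mono fun y hy => ⟨hr.1.trans_le hy.1, hy.2⟩)
      fun y hy => hdv y ⟨hr.1.trans hy.1, hy.2⟩
    rw [hzero x ⟨hr.1.trans hx.1, hx.2.le⟩, eq_comm, div_eq_zero_iff, hvρ] at hxe
    rcases hxe with hxe | hxe <;> linarith
  intro r hr
  exact (mul_eq_zero.1 (hconst r hr)).resolve_left (Real.rpow_pos_of_pos hr.1 _).ne'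

end Radial

/-! ### Smoothness and assembly of the theorem. -/

/-- Bootstrap on the pair `(f, f')`: the equation expresses the derivative of each through the pair
and smooth coefficients, so each round gains one order. -/
theorem contDiffOn_of_singularODE {n : ℕ} {μ c : ℝ} {f f₁ : ℝ → ℝ} (hc : c ≤ 0)
    (hd : ∀ r > 0, HasDerivAt f (f₁ r) r)
    (hd₁ : ∀ r > 0, HasDerivAt f₁ (-(((n : ℝ) - 1) * f₁ r * ct c r) - μ * (f r / r ^ 2) - 1) r) :
    ContDiffOn ℝ ∞ f (Set.Ioi 0) := by
  have key : ∀ m : ℕ, ContDiffOn ℝ m f (Set.Ioi 0) ∧ ContDiffOn ℝ m f₁ (Set.Ioi 0) := by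
    intro m
    induction m with
    | zero =>
      simp only [Nat.cast_zero, contDiffOn_zero]
      exact ⟨fun r hr => (hd r hr).continuousAt.continuousWithinAt,
        fun r hr => (hd₁ r hr).continuousAt.continuousWithinAt⟩
    | succ m ih =>
      obtain ⟨ih, ih₁⟩ := ih
      have hct : ContDiffOn ℝ m (ct c) (Set.Ioi 0) :=
        (contDiffOn_ct hc).of_le (by exact_mod_cast le_top)
      have hrhs : ContDiffOn ℝ m
          (fun r => -(((n : ℝ) - 1) * f₁ r * ct c r) - μ * (f r / r ^ 2) - 1) (Set.Ioi 0) :=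
        ((((contDiffOn_const.mul ih₁).mul hct).neg).sub (contDiffOn_const.mul
          (ih.div (contDiffOn_id.pow 2) fun x hx => pow_ne_zero 2 (ne_of_gt hx)))).sub
          contDiffOn_const
      push_cast
      rw [contDiffOn_succ_iff_deriv_of_isOpen isOpen_Ioi,
        contDiffOn_succ_iff_deriv_of_isOpen isOpen_Ioi]
      refine ⟨⟨fun r hr => (hd r hr).differentiableAt.differentiableWithinAt, by simp,
        ih₁.congr fun r hr => (hd r hr).deriv⟩,
        ⟨fun r hr => (hd₁ r hr).differentiableAt.differentiableWithinAt, by simp,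
        hrhs.congr fun r hr => (hd₁ r hr).deriv⟩⟩
  exact contDiffOn_infty.2 fun m => (key m).1

theorem integrableOn_sub_sq_mul_pow {n : ℕ} {ρ : ℝ} {a b : ℝ → ℝ}
    (ha : ContinuousOn a (Set.Ioc 0 ρ)) (hb : ContinuousOn b (Set.Ioc 0 ρ))
    (hia : MeasureTheory.IntegrableOn (fun r => a r ^ 2 * r ^ (n - 1)) (Set.Ioc 0 ρ))
    (hib : MeasureTheory.IntegrableOn (fun r => b r ^ 2 * r ^ (n - 1)) (Set.Ioc 0 ρ)) :
    MeasureTheory.IntegrableOn (fun r => (a r - b r) ^ 2 * r ^ (n - 1)) (Set.Ioc 0 ρ) := by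
  refine ((hia.add hib).const_mul 2).mono' ?_ ?_
  · exact (((ha.sub hb).pow 2).mul (continuous_pow _).continuousOn).aestronglyMeasurable
      measurableSet_Ioc
  · refine (MeasureTheory.ae_restrict_iff' measurableSet_Ioc).2 (.of_forall fun r hr => ?_)
    have hp : 0 < r ^ (n - 1) := pow_pos hr.1 _
    rw [Real.norm_of_nonneg (by positivity)]
    have h1 : (a r - b r) ^ 2 ≤ 2 * (a r ^ 2 + b r ^ 2) := by
      linarith [sq_nonneg (a r + b r), show (a r - b r) ^ 2 + (a r + b r) ^ 2
        = 2 * (a r ^ 2 + b r ^ 2) by ring]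
    calc _ ≤ 2 * (a r ^ 2 + b r ^ 2) * r ^ (n - 1) := mul_le_mul_of_nonneg_right h1 hp.le
      _ = _ := by
        simp only [Pi.add_apply]
        ring

theorem mainTheorem10 (n : ℕ) (hn : 3 ≤ n) (μ c ρ : ℝ)
    (hμ : 0 ≤ μ) (hμ' : μ < ((n : ℝ) - 2) ^ 2 / 4) (hc : c ≤ 0) (hρ : 0 < ρ) :
    ∃ f : ℝ → ℝ,
      IsSingularODESolution n μ c ρ f ∧
      (∀ r ∈ Set.Ioc 0 ρ, 0 ≤ f r) ∧
      AntitoneOn f (Set.Ioc 0 ρ) ∧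
      ContDiffOn ℝ ∞ f (Set.Ioo 0 ρ) ∧
      ∀ g : ℝ → ℝ, IsSingularODESolution n μ c ρ g → Set.EqOn g f (Set.Ioc 0 ρ) := by
  have hn' : (3 : ℝ) ≤ n := by exact_mod_cast hn
  obtain ⟨γ, hγ, hγn, hμγ⟩ : ∃ γ : ℝ, 0 ≤ γ ∧ 2 * γ < (n : ℝ) - 2 ∧
      μ = γ * ((n : ℝ) - 2) - γ ^ 2 := by
    have h1 : 0 < ((n : ℝ) - 2) ^ 2 / 4 - μ := by linarith
    have h2 := Real.sq_sqrt h1.le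
    -- The smaller root: `μ ≥ 0` makes it non-negative, and the strict bound on `μ` puts it strictly
    -- below `(n-2)/2`.
    refine ⟨((n : ℝ) - 2) / 2 - √(((n : ℝ) - 2) ^ 2 / 4 - μ), ?_, ?_, ?_⟩
    · rw [sub_nonneg, Real.sqrt_le_left (by linarith)]
      linarith [show (((n : ℝ) - 2) / 2) ^ 2 = ((n : ℝ) - 2) ^ 2 / 4 by ring]
    · have := Real.sqrt_pos.2 h1
      linarith
    · generalize √(((n : ℝ) - 2) ^ 2 / 4 - μ) = d at h2
      linarith [show (((n : ℝ) - 2) / 2 - d) * ((n : ℝ) - 2) - (((n : ℝ) - 2) / 2 - d) ^ 2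
        = ((n : ℝ) - 2) ^ 2 / 4 - d ^ 2 by ring]
  obtain ⟨f, f₁, K, hfρ, hf0, hd, hd₁, hK⟩ :=
    exists_bounded_singularity_solution hn hc hγ hγn hμγ hρ
  have hfc : ContinuousOn f (Set.Ioc 0 ρ) := fun r hr =>
    (hd r hr.1).continuousAt.continuousWithinAt
  have hf₁c : ContinuousOn f₁ (Set.Ioc 0 ρ) := fun r hr =>
    (hd₁ r hr.1).continuousAt.continuousWithinAt
  have hE := integrableOn_sq_mul_pow hn hγn hρ hf₁c hK
  have hud : UniqueDiffOn ℝ (Set.Ioc 0 ρ) := uniqueDiffOn_Ioc 0 ρ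
  have hdw : Set.EqOn (derivWithin f (Set.Ioc 0 ρ)) f₁ (Set.Ioc 0 ρ) := fun r hr =>
    (hd r hr.1).hasDerivWithinAt.derivWithin (hud r hr)
  have hsol : IsSingularODESolution n μ c ρ f := by
    refine ⟨fun r hr => (hd r hr.1).differentiableAt.differentiableWithinAt, ?_, ?_, hfρ, ?_⟩
    · exact DifferentiableOn.congr
        (fun r hr => (hd₁ r hr.1).differentiableAt.differentiableWithinAt) hdw
    · intro r hr
      rw [derivWithin_congr hdw (hdw hr), hdw hr,
        (hd₁ r hr.1).hasDerivWithinAt.derivWithin (hud r hr)]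
      ring
    · refine hE.congr_fun (fun r hr => ?_) measurableSet_Ioc
      simp only [hdw hr]
  refine ⟨f, hsol, hf0, ?_, (contDiffOn_of_singularODE hc hd hd₁).mono Set.Ioo_subset_Ioi_self,
    fun g hg r hr => ?_⟩
  · refine antitoneOn_of_deriv_nonpos (convex_Ioc 0 ρ) hfc
      (fun r hr => (hd r (interior_subset hr).1).differentiableAt.differentiableWithinAt)
      fun r hr => ?_
    rw [(hd r (interior_subset hr).1).deriv]
    exact deriv_nonpos_of_nonneg_solution hn hc hγ hγn hμ hρ hf0 hd₁ hK r (interior_subset hr)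
  -- On the open interval the relative derivatives are ordinary ones, and the constant term cancels
  -- in `g - f`.
  · set g₁ := derivWithin g (Set.Ioc 0 ρ) with hg₁
    have hnhds : ∀ x ∈ Set.Ioo 0 ρ, Set.Ioc 0 ρ ∈ 𝓝 x := fun x hx => Ioc_mem_nhds hx.1 hx.2
    have hdg : ∀ x ∈ Set.Ioo 0 ρ, HasDerivAt g (g₁ x) x := fun x hx =>
      (hg.differentiableOn x ⟨hx.1, hx.2.le⟩).hasDerivWithinAt.hasDerivAt (hnhds x hx)
    have hdg₁ : ∀ x ∈ Set.Ioo 0 ρ, HasDerivAt g₁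
        (-(((n : ℝ) - 1) * g₁ x * ct c x) - μ * (g x / x ^ 2) - 1) x := by
      intro x hx
      have h1 := hg.ode x ⟨hx.1, hx.2.le⟩
      refine ((hg.differentiableOn_deriv x ⟨hx.1, hx.2.le⟩).hasDerivWithinAt.hasDerivAt
        (hnhds x hx)).congr_deriv ?_
      linarith
    have hgc := hg.differentiableOn.continuousOn
    have hg₁c := hg.differentiableOn_deriv.continuousOn
    have h0 := homogeneous_solution_eq_zero (h := fun x => g x - f x)
      (h₁ := fun x => g₁ x - f₁ x) hn hc hγ hγn hμγ hρ (hgc.sub hfc) (hg₁c.sub hf₁c)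
      (fun x hx => (hdg x hx).sub (hd x hx.1))
      (fun x hx => ((hdg₁ x hx).sub (hd₁ x hx.1)).congr_deriv (by ring))
      (by simp [hg.boundary, hfρ])
      (integrableOn_sub_sq_mul_pow hg₁c hf₁c hg.finite_energy hE) r hr
    exact sub_eq_zero.1 h0
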